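/- Let $\mathbb F_q$ be a finite field and let $n,k,\ell,m$ be integers with $k\ge 2$, $d=2k-2\le n-1$, $0\le m\le \ell<k$; put $\alpha=k-1$. **Codes.** A storage code for $n$ nodes with parameters $(\alpha',\beta')$ encodes $B^*$ message symbols and $R$ random symbols from $\mathbb F_q$ into $\alpha'$ symbols per node; for the repair of a failed node $f$ by a set $H$ of helpers, $f\notin H$, $|H|=d$, each helper passes $\beta'$ symbols that are functions of its stored data (and of $f,H$). The code is an $[n,k,d]$ MSR code if $B^*+R=k\alpha'$, $d\beta'=\alpha'+(k-1)\beta'$, the data stored in any $k$ nodes determine all $B^*+R$ input symbols, and the symbols passed by any $d$ helpers determine the data of the failed node. It is $\{\ell,m\}$-secure if, whenever the random symbols are uniform on $\mathbb F_q$, independent of each other and of the message (whose distribution is arbitrary), the mutual information between the message and the view of any eavesdropper is $0$; here the view consists of the data stored in some at most $\ell$ nodes and of all data passed in any number of repair operations of at most $m$ of these nodes. **The code $\mathcal C^*$** ($\beta=1$). Let $\Phi$ be an $n\times\alpha$ matrix and $\Lambda$ an $n\times n$ diagonal matrix over $\mathbb F_q$, and $\Psi^*=[\Phi\ \ \Lambda\Phi]$.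 Call $(\Phi,\Lambda)$ admissible if any $\alpha$ rows of $\Phi$ are linearly independent, any $d$ rows of $\Psi^*$ are linearly independent, the diagonal entries of $\Lambda$ are distinct, and for each $j\in\{\ell,\ \max(\ell-1,0),\ m\}$ any $j$ rows of $\Psi^*$ restricted to its first $j$ columns are linearly independent. Let $S_1^*,S_2^*$ be symmetric $\alpha\times\alpha$ matrices whose $\alpha(\alpha+1)$ free entries are filled as follows: the entries in the first $\ell$ rows (and columns) of $S_1^*$, those in the intersection of the first $\ell-1$ rows and first $\ell-1$ columns of $S_2^*$ (none if $\ell=0$), and those in the first $m$ rows (and columns) of $S_2^*$ are random symbols; all other entries are message symbols. Node $i$ stores the $i$-th row of $\Psi^* M^*$, where $M^*=\begin{bmatrix}S_1^*\\ S_2^*\end{bmatrix}$; to repair node $f$, each helper passes the inner product of its stored data with the $f$-th row of $\Phi$. **Theorem.** 1. $\mathcal C^*$ has $R=\ell\alpha+(k-\ell)m$ random symbols and $B^*=(k-\ell)(\alpha-m)$ message symbols. 2. For every admissible $(\Phi,\Lambda)$, $\mathcal C^*$ is an $[n,k,d]$ MSR code and is $\{\ell,m\}$-secure. 3. If $x_1,\dots,x_n\in\mathbb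 F_q$ have pairwise distinct powers $x_i^{\alpha}$, then the Vandermonde choice $\Phi=(x_i^{c})_{1\le i\le n,\,0\le c<\alpha}$, $\Lambda=\mathrm{diag}(x_1^\alpha,\dots,x_n^\alpha)$ is admissible. 4. If $m\le 1$, every (not necessarily linear) $\{\ell,m\}$-secure $[n,k,d]$ MSR code over $\mathbb F_q$ with parameters $(\alpha',\beta')$ has at most $(k-\ell)(\alpha'-m\beta')$ message symbols; so the message size $B^*$ of $\mathcal C^*$ is optimal. -/

import Mathlib

open MeasureTheory ProbabilityTheory

noncomputable section

namespace SecureMSR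

/-! ### Mutual information -/

/-- Mutual information `I(X;Y)`: the Kullback–Leibler divergence of the joint law of `(X,Y)`
from the product of the marginal laws. -/
def mutualInformation {Ω X Y : Type*} [MeasurableSpace Ω] [MeasurableSpace X]
    [MeasurableSpace Y] (μ : Measure Ω) (f : Ω → X) (g : Ω → Y) : ENNReal :=
  InformationTheory.klDiv (μ.map fun ω => (f ω, g ω)) ((μ.map f).prod (μ.map g))

/-! ### Storage codes with repair -/

/-- A (not necessarily linear) code over the alphabet `A` for `n` nodes that store `α` symbols
each. Its input consists of message symbols, indexed by `ι`, and random symbols, indexed by `ρ`.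
When the failed node `f` is repaired with the help of the nodes in `H`, the helper `j ∈ H`, whose
stored data is `x`, passes the `β` symbols `send f H j x`. -/
structure StorageCode (A ι ρ : Type*) (n α β : ℕ) where
  store : (ι → A) → (ρ → A) → Fin n → (Fin α → A)
  send : Fin n → Finset (Fin n) → Fin n → (Fin α → A) → (Fin β → A)

/-- A repair operation: a failed node and a set of `d` helpers among the remaining nodes. -/
structure RepairOp (n d : ℕ) where
  failed : Fin n
  helpers : Finset (Fin n)
  card_helpers : helpers.card = d
  failed_notMem : failed ∉ helpers

/-- An `{ℓ, m}`-eavesdropper: it reads the data stored in at most `ℓ` nodes, and it listens to a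
sequence of arbitrarily many repair operations of at most `m` of these nodes. -/
structure Eavesdropper (n d ℓ m : ℕ) where
  stored : Finset (Fin n)
  card_stored : stored.card ≤ ℓ
  repaired : Finset (Fin n)
  repaired_subset : repaired ⊆ stored
  card_repaired : repaired.card ≤ m
  numOps : ℕ
  op : Fin numOps → RepairOp n d
  op_failed_mem : ∀ t, (op t).failed ∈ repaired

namespace StorageCode

variable {A ι ρ : Type*} {n α β : ℕ}

/-- All input symbols, message and random ones, are determined by the data stored in any `k`
nodes. -/
def CanReconstruct (C : StorageCode A ι ρ n α β) (k : ℕ) : Prop :=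
  ∀ K : Finset (Fin n), K.card = k → ∀ u u' r r',
    (∀ i ∈ K, C.store u r i = C.store u' r' i) → u = u' ∧ r = r'

/-- The data stored in any failed node is determined by the symbols that any `d` of the remaining
nodes pass to it. -/
def CanRepair (C : StorageCode A ι ρ n α β) (d : ℕ) : Prop :=
  ∀ op : RepairOp n d, ∀ u u' r r',
    (∀ j ∈ op.helpers, C.send op.failed op.helpers j (C.store u r j) =
      C.send op.failed op.helpers j (C.store u' r' j)) →
    C.store u r op.failed = C.store u' r' op.failed

/-- The code is an `[n, k, d]` minimum storage regenerating code: its `B` input symbols (message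
and random symbols together) satisfy `B = kα`, moreover `dβ = α + (k-1)β`, and reconstruction from
any `k` nodes and repair from any `d` nodes are possible. -/
structure IsMSR [Fintype ι] [Fintype ρ] (C : StorageCode A ι ρ n α β) (k d : ℕ) : Prop where
  card_input : Fintype.card ι + Fintype.card ρ = k * α
  repair_bandwidth : d * β = α + (k - 1) * β
  reconstruct : C.CanReconstruct k
  repair : C.CanRepair d

/-- What the eavesdropper sees, when the message is `u` and the random symbols are `r`. -/
def view {d ℓ m : ℕ} (C : StorageCode A ι ρ n α β) (E : Eavesdropper n d ℓ m)
    (u : ι → A) (r : ρ → A) :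
    (E.stored → Fin α → A) × ((t : Fin E.numOps) → (E.op t).helpers → Fin β → A) :=
  (fun i => C.store u r i,
   fun t j => C.send (E.op t).failed (E.op t).helpers j (C.store u r j))

/-- `{ℓ, m}`-security: whatever the distribution `ν` of the message is, if the random symbols are
uniform on `A`, independent of each other and of the message, then no `{ℓ, m}`-eavesdropper gets
any information about the message. -/
def IsSecure [Fintype ρ] [MeasurableSpace A] (C : StorageCode A ι ρ n α β) (d ℓ m : ℕ) : Prop :=
  ∀ (ν : Measure (ι → A)) [IsProbabilityMeasure ν] (E : Eavesdropper n d ℓ m),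
    mutualInformation (ν.prod (Measure.pi fun _ : ρ => uniformOn (Set.univ : Set A)))
      (fun ω => ω.1) (fun ω => C.view E ω.1 ω.2) = 0

end StorageCode

/-! ### The secure product-matrix code for `d = 2k - 2`, `α = k - 1`, `β = 1` -/

/-- The free entries of the two symmetric matrices: `(0, s(i, j))` is the entry of `S₁`, and
`(1, s(i, j))` the entry of `S₂`, in the positions `(i, j)` and `(j, i)`. -/
abbrev Position (α : ℕ) : Type := Fin 2 × Sym2 (Fin α)

/-- The entries that hold random symbols: the first `ℓ` rows and columns of `S₁`; the
intersection of the first `ℓ - 1` rows and the first `ℓ - 1` columns of `S₂`; the first `m` rows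
and columns of `S₂`. All other entries hold message symbols. -/
def randomPositions (α ℓ m : ℕ) : Finset (Position α) :=
  {p | (p.1 = 0 ∧ ∃ i ∈ p.2, i.val < ℓ) ∨
    (p.1 = 1 ∧ ((∀ i ∈ p.2, i.val < ℓ - 1) ∨ ∃ i ∈ p.2, i.val < m))}

/-- The indices of the message symbols. -/
abbrev MessageIndex (α ℓ m : ℕ) : Type := {p : Position α // p ∉ randomPositions α ℓ m}

/-- The indices of the random symbols. -/
abbrev RandomIndex (α ℓ m : ℕ) : Type := {p : Position α // p ∈ randomPositions α ℓ m}

variable {F : Type*}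

/-- The symmetric matrices `S₁` (`s = 0`) and `S₂` (`s = 1`). -/
def symmMatrix {α ℓ m : ℕ} (u : MessageIndex α ℓ m → F) (r : RandomIndex α ℓ m → F) (s : Fin 2) :
    Matrix (Fin α) (Fin α) F :=
  Matrix.of fun i j =>
    if h : (s, s(i, j)) ∈ randomPositions α ℓ m then r ⟨_, h⟩ else u ⟨_, h⟩

/-- The message matrix, `S₁` on top of `S₂`. -/
def messageMatrix {α ℓ m : ℕ} (u : MessageIndex α ℓ m → F) (r : RandomIndex α ℓ m → F) :
    Matrix (Fin α ⊕ Fin α) (Fin α) F :=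
  Matrix.fromRows (symmMatrix u r 0) (symmMatrix u r 1)

/-- The encoding matrix `Ψ = [Φ  ΛΦ]`, where `Λ` is the diagonal matrix with diagonal `lam`. -/
def encodingMatrix [Field F] {n α : ℕ} (Φ : Matrix (Fin n) (Fin α) F) (lam : Fin n → F) :
    Matrix (Fin n) (Fin α ⊕ Fin α) F :=
  Matrix.fromCols Φ (Matrix.diagonal lam * Φ)

/-- Any `j` rows of the matrix are linearly independent. -/
def AnyRowsIndependent [Field F] {n : ℕ} {κ : Type*} (j : ℕ) (A : Matrix (Fin n) κ F) : Prop :=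
  ∀ I : Finset (Fin n), I.card = j → LinearIndependent F fun i : I => A i

/-- The restriction of a matrix to its first `j` columns. -/
def firstColumns {n α : ℕ} (j : ℕ) (A : Matrix (Fin n) (Fin α) F) :
    Matrix (Fin n) {c : Fin α // c.val < j} F :=
  A.submatrix id Subtype.val

/-- The requirements on `Φ` and `Λ = diag(lam)`. The first `j ≤ α` columns of `Ψ` are the first
`j` columns of `Φ`. -/
structure IsAdmissible [Field F] {n α : ℕ} (Φ : Matrix (Fin n) (Fin α) F) (lam : Fin n → F)
    (ℓ m : ℕ) : Prop where
  phi_rows : AnyRowsIndependent α Φ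
  psi_rows : AnyRowsIndependent (2 * α) (encodingMatrix Φ lam)
  lam_injective : Function.Injective lam
  first_ell : AnyRowsIndependent ℓ (firstColumns ℓ Φ)
  first_ell_sub_one : AnyRowsIndependent (ℓ - 1) (firstColumns (ℓ - 1) Φ)
  first_m : AnyRowsIndependent m (firstColumns m Φ)

/-- The secure code: node `i` stores row `i` of `Ψ M`; for the repair of node `f`, each helper
passes the inner product of its stored data with row `f` of `Φ`. -/
def secureCode [Field F] {n α : ℕ} (Φ : Matrix (Fin n) (Fin α) F) (lam : Fin n → F) (ℓ m : ℕ) :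
    StorageCode F (MessageIndex α ℓ m) (RandomIndex α ℓ m) n α 1 where
  store u r i := (encodingMatrix Φ lam * messageMatrix u r) i
  send f _ _ x := fun _ => x ⬝ᵥ Φ f

end SecureMSR

end

/-!
As `λᵢ ≠ λⱼ`, the data of two nodes determine `φⱼᵀ S₁ φᵢ` and `φⱼᵀ S₂ φᵢ`, so `α + 1` nodes
determine `S₁` and `S₂`. By symmetry, a helper of node `f` passes the inner product of its row of
`Ψ` with `(S₁ φ_f, S₂ φ_f)`, so `2α` helpers determine this pair.

For security, enlarge the eavesdropper to one that reads exactly `ℓ` nodes and knows `S₂ φ_f` for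
exactly `m` of them. Given the stored data, `S₂ φ_f` amounts to `α + 1 - ℓ` further coordinates, so
the view has as many coordinates as there are random symbols. The positions of the random symbols
are chosen such that a zero message with a zero view has zero random symbols. Hence, for a fixed
message, the view is a bijective function of the random symbols, and every message occurs together
with the zero view. By linearity, changing the message has the same effect on the view as
translating the random symbols, which are uniform.

For the upper bound, fix a view of a secure code: every message is compatible with it and is
determined by the contents of the `k - ℓ` nodes among some `k` that are not read. If the
eavesdropper hears the `β` symbols passed by such a node in a repair, then that node has only
`|A| ^ ((d - k)β) = |A| ^ (α - β)` possible contents.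
-/

namespace SecureMSR

/-! ### Counting the symbols -/

section Counting

variable {α ℓ m : ℕ}

theorem card_sym2_filter_le_lt (α a b : ℕ) :
    (Finset.univ.filter fun z : Sym2 (Fin α) => ∀ i ∈ z, a ≤ i.val ∧ i.val < b).card =
      (min α b - a + 1).choose 2 := by
  have hsym2 : (Finset.univ.filter fun z : Sym2 (Fin α) => ∀ i ∈ z, a ≤ i.val ∧ i.val < b) =
      (Finset.univ.filter fun i : Fin α => a ≤ i.val ∧ i.val < b).sym2 := by
    ext z
    simp only [Finset.mem_filter, Finset.mem_univ, true_and, Finset.mem_sym2_iff]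
  have hIco : (Finset.univ.filter fun i : Fin α => a ≤ i.val ∧ i.val < b).map Fin.valEmbedding =
      Finset.Ico a (min α b) := by
    ext i
    simp only [Finset.mem_map, Finset.mem_filter, Finset.mem_univ, true_and,
      Fin.valEmbedding_apply, Finset.mem_Ico, lt_min_iff]
    exact ⟨fun ⟨j, hj, hji⟩ => hji ▸ ⟨hj.1, j.isLt, hj.2⟩,
      fun h => ⟨⟨i, h.2.1⟩, ⟨h.1, h.2.2⟩, rfl⟩⟩
  rw [hsym2, Finset.card_sym2, ← Finset.card_map Fin.valEmbedding, hIco, Nat.card_Ico]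

theorem card_sym2_filter_le (α a : ℕ) :
    (Finset.univ.filter fun z : Sym2 (Fin α) => ∀ i ∈ z, a ≤ i.val).card =
      (α - a + 1).choose 2 := by
  simpa using card_sym2_filter_le_lt α a α

theorem notMem_randomPositions_zero {z : Sym2 (Fin α)} :
    (0, z) ∉ randomPositions α ℓ m ↔ ∀ i ∈ z, ℓ ≤ i.val := by
  simp [randomPositions]

theorem notMem_randomPositions_one {z : Sym2 (Fin α)} :
    (1, z) ∉ randomPositions α ℓ m ↔
      (∀ i ∈ z, m ≤ i.val) ∧ ¬ ∀ i ∈ z, i.val < ℓ - 1 := by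
  simp only [randomPositions, Finset.mem_filter, Finset.mem_univ, true_and, one_ne_zero, false_and,
    false_or, not_or, not_exists, not_and, not_lt]
  exact and_comm

theorem card_notMem_randomPositions_one (hℓ : ℓ ≤ α) :
    (Finset.univ.filter fun z : Sym2 (Fin α) => (1, z) ∉ randomPositions α ℓ m).card +
      (ℓ - 1 - m + 1).choose 2 = (α - m + 1).choose 2 := by
  have hmin : min α (ℓ - 1) = ℓ - 1 := by omega
  simp only [notMem_randomPositions_one]
  rw [← card_sym2_filter_le α m, ← hmin, ← card_sym2_filter_le_lt α m (ℓ - 1), add_comm]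
  simp only [forall_and, hmin]
  simp only [← Finset.filter_filter]
  exact Finset.card_filter_add_card_filter_not _

theorem card_messageIndex_eq_add (α ℓ m : ℕ) :
    Fintype.card (MessageIndex α ℓ m) =
      (Finset.univ.filter fun z : Sym2 (Fin α) => (0, z) ∉ randomPositions α ℓ m).card +
      (Finset.univ.filter fun z : Sym2 (Fin α) => (1, z) ∉ randomPositions α ℓ m).card := by
  simp only [Fintype.card_subtype, Finset.card_filter, Fintype.sum_prod_type, Fin.sum_univ_two]

theorem choose_two_succ_add_choose_two_succ (a b : ℕ) :
    (a + 1).choose 2 + (a + b + 1).choose 2 = (a + 1) * (a + b) + b.choose 2 := by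
  qify
  simp only [Nat.cast_choose_two]
  push_cast
  ring

theorem card_messageIndex (hℓ : ℓ ≤ α) (hm : m ≤ ℓ) :
    Fintype.card (MessageIndex α ℓ m) = (α + 1 - ℓ) * (α - m) := by
  obtain ⟨b, rfl⟩ := Nat.exists_eq_add_of_le hm
  obtain ⟨a, rfl⟩ := Nat.exists_eq_add_of_le hℓ
  have hfirst : (Finset.univ.filter fun z : Sym2 (Fin (m + b + a)) =>
      (0, z) ∉ randomPositions (m + b + a) (m + b) m).card = (a + 1).choose 2 := by
    simp only [notMem_randomPositions_zero, card_sym2_filter_le, Nat.add_sub_cancel_left]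
  have hsecond := card_notMem_randomPositions_one (m := m) hℓ
  have hcorner : (m + b - 1 - m + 1).choose 2 = b.choose 2 := by
    rw [show m + b - 1 - m = b - 1 by omega]
    cases b <;> rfl
  rw [hcorner, show m + b + a - m = a + b by omega] at hsecond
  have hsum := choose_two_succ_add_choose_two_succ a b
  rw [card_messageIndex_eq_add, hfirst, show m + b + a + 1 - (m + b) = a + 1 by omega,
    show m + b + a - m = a + b by omega]
  omega

theorem card_randomIndex_add_card_messageIndex (α ℓ m : ℕ) :
    Fintype.card (RandomIndex α ℓ m) + Fintype.card (MessageIndex α ℓ m) = α * (α + 1) := by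
  rw [Fintype.card_subtype_compl, Nat.add_sub_cancel' (Fintype.card_subtype_le _),
    Fintype.card_prod, Fintype.card_fin, Sym2.card, Fintype.card_fin, Nat.choose_two_right,
    Nat.add_sub_cancel, mul_comm (α + 1), Nat.mul_div_cancel' (Nat.even_mul_succ_self α).two_dvd]

theorem card_randomIndex (hℓ : ℓ ≤ α) (hm : m ≤ ℓ) :
    Fintype.card (RandomIndex α ℓ m) = ℓ * α + (α + 1 - ℓ) * m := by
  have htotal := card_randomIndex_add_card_messageIndex α ℓ m
  rw [card_messageIndex hℓ hm] at htotal
  zify [hm.trans hℓ, hℓ.trans (Nat.le_succ α)] at htotal ⊢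
  linear_combination htotal

end Counting

/-! ### Linear algebra -/

section LinearAlgebra

open Matrix

variable {F : Type*} [Field F] {n j : ℕ}

namespace AnyRowsIndependent

variable {κ : Type*} [Fintype κ] {A : Matrix (Fin n) κ F} {I : Finset (Fin n)}

theorem eq_zero_of_dotProduct_eq_zero (hA : AnyRowsIndependent j A) (hκ : Fintype.card κ ≤ j)
    (hI : I.card = j) {v : κ → F} (hv : ∀ i ∈ I, v ⬝ᵥ A i = 0) : v = 0 := by
  have hspan : Submodule.span F (Set.range fun i : I => A i) = ⊤ := by
    refine (hA I hI).span_eq_top_of_card_eq_finrank' (le_antisymm ?_ ?_)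
    · exact (hA I hI).fintype_card_le_finrank
    · simpa only [Module.finrank_fintype_fun_eq_card, Fintype.card_coe, hI] using hκ
  have hle : Submodule.span F (Set.range fun i : I => A i) ≤
      LinearMap.ker (dotProductBilin F F v) := by
    rw [Submodule.span_le]
    rintro _ ⟨i, rfl⟩
    exact hv i i.2
  rw [hspan] at hle
  exact dotProduct_eq_zero v fun w => hle (Submodule.mem_top : w ∈ _)

theorem eq_zero_of_mulVec_eq_zero {κ' : Type*} (hA : AnyRowsIndependent j A)
    (hκ : Fintype.card κ ≤ j) (hI : I.card = j) {S : Matrix κ' κ F}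
    (hS : ∀ i ∈ I, S *ᵥ A i = 0) : S = 0 :=
  funext fun c => hA.eq_zero_of_dotProduct_eq_zero hκ hI fun i hi => congrFun (hS i hi) c

end AnyRowsIndependent

theorem dotProduct_firstColumns {α : ℕ} {v : Fin α → F} (hv : ∀ c, j ≤ c.val → v c = 0)
    (Φ : Matrix (Fin n) (Fin α) F) (i : Fin n) :
    (fun c : {c : Fin α // c.val < j} => v c) ⬝ᵥ firstColumns j Φ i = v ⬝ᵥ Φ i := by
  simp only [dotProduct, firstColumns, submatrix_apply, id]
  rw [← Fintype.sum_subtype_add_sum_subtype (fun c : Fin α => c.val < j) fun c => v c * Φ i c,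
    left_eq_add]
  exact Finset.sum_eq_zero fun c _ => by rw [hv c (not_lt.1 c.2), zero_mul]

namespace AnyRowsIndependent

variable {α : ℕ} {Φ : Matrix (Fin n) (Fin α) F} {I : Finset (Fin n)}

theorem eq_zero_of_dotProduct_firstColumns (hΦ : AnyRowsIndependent j (firstColumns j Φ))
    (hI : I.card = j) {v : Fin α → F} (hv : ∀ c, j ≤ c.val → v c = 0)
    (hvI : ∀ i ∈ I, v ⬝ᵥ Φ i = 0) : v = 0 := by
  have hcard : Fintype.card {c : Fin α // c.val < j} ≤ j := by
    rw [← Fintype.card_fin j]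
    exact Fintype.card_le_of_injective (fun c => ⟨c.1, by simpa using c.2⟩) fun c c' h => by
      simpa [Fin.ext_iff, Subtype.ext_iff] using h
  have hrestrict := hΦ.eq_zero_of_dotProduct_eq_zero hcard hI fun i hi =>
    (dotProduct_firstColumns hv Φ i).trans (hvI i hi)
  ext c
  exact (lt_or_ge c.val j).elim (fun hc => congrFun hrestrict ⟨c, hc⟩) (hv c)

/-- After the last rows vanish, so do the last columns by symmetry, hence all rows. -/
theorem eq_zero_of_isSymm_of_mulVec_firstColumns (hΦ : AnyRowsIndependent j (firstColumns j Φ))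
    (hI : I.card = j) {S : Matrix (Fin α) (Fin α) F} (hS : S.IsSymm)
    (hSj : ∀ c c', j ≤ c.val → j ≤ c'.val → S c c' = 0) (hSI : ∀ i ∈ I, S *ᵥ Φ i = 0) :
    S = 0 := by
  have hrow : ∀ c, j ≤ c.val → S c = 0 := fun c hc =>
    hΦ.eq_zero_of_dotProduct_firstColumns hI (hSj c · hc) fun i hi => congrFun (hSI i hi) c
  refine funext fun c => hΦ.eq_zero_of_dotProduct_firstColumns hI (fun c' hc' => ?_)
    fun i hi => congrFun (hSI i hi) c
  rw [← hS.apply, hrow c' hc', Pi.zero_apply]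

end AnyRowsIndependent

theorem anyRowsIndependent_pow {κ : Type*} {x : Fin n → F} (hx : Function.Injective x)
    (g : κ ≃ Fin j) {A : Matrix (Fin n) κ F} (hA : ∀ i c, A i c = x i ^ (g c : ℕ)) :
    AnyRowsIndependent j A := by
  intro I hI
  let e : Fin j ≃ I := (finCongr hI.symm).trans I.equivFin.symm
  have hdet : (vandermonde fun t => x (e t)).det ≠ 0 :=
    det_vandermonde_ne_zero_iff.2 (hx.comp (Subtype.val_injective.comp e.injective))
  have hrows := (linearIndependent_rows_of_det_ne_zero hdet).map'
    (LinearEquiv.funCongrLeft F F g).toLinearMap (LinearEquiv.ker _)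
  have hcomp : (fun i : I => A i) ∘ e =
      (LinearEquiv.funCongrLeft F F g).toLinearMap ∘ (vandermonde fun t => x (e t)).row := by
    ext t c
    exact hA (e t) c
  rwa [← linearIndependent_equiv e, hcomp]

theorem encodingMatrix_apply {α : ℕ} (Φ : Matrix (Fin n) (Fin α) F) (lam : Fin n → F)
    (i : Fin n) : encodingMatrix Φ lam i = Sum.elim (Φ i) (lam i • Φ i) := by
  ext (c | c) <;>
    simp only [encodingMatrix, fromCols_apply_inl, fromCols_apply_inr, diagonal_mul,
      Sum.elim_inl, Sum.elim_inr, Pi.smul_apply, smul_eq_mul]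

theorem isAdmissible_vandermonde {α ℓ m : ℕ} (hℓ : ℓ ≤ α) (hm : m ≤ α) {x : Fin n → F}
    (hx : Function.Injective fun i => x i ^ α) :
    IsAdmissible (of fun i (c : Fin α) => x i ^ (c : ℕ)) (fun i => x i ^ α) ℓ m := by
  have hx' : Function.Injective x := hx.of_comp (f := fun y => y ^ α)
  have hfirst : ∀ j ≤ α,
      AnyRowsIndependent j (firstColumns j (of fun i (c : Fin α) => x i ^ (c : ℕ))) :=
    fun j hj => anyRowsIndependent_pow hx'
      ⟨fun c => ⟨c.1, c.2⟩, fun t => ⟨⟨t, t.2.trans_le hj⟩, t.2⟩, fun _ => rfl, fun _ => rfl⟩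
      fun _ _ => rfl
  refine ⟨anyRowsIndependent_pow hx' (Equiv.refl _) fun _ _ => rfl, ?_, hx, hfirst _ hℓ,
    hfirst _ ((Nat.sub_le ..).trans hℓ), hfirst _ hm⟩
  refine anyRowsIndependent_pow hx' (finSumFinEquiv.trans (finCongr (two_mul α).symm)) ?_
  rintro i (c | c) <;> simp [encodingMatrix_apply, pow_add, mul_comm]

end LinearAlgebra

/-! ### Reconstruction and repair -/

section Code

open Matrix

theorem dotProduct_mulVec_comm_of_isSymm {R κ : Type*} [CommSemiring R] [Fintype κ]
    {S : Matrix κ κ R} (hS : S.IsSymm) (v w : κ → R) : v ⬝ᵥ S *ᵥ w = w ⬝ᵥ S *ᵥ v := by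
  rw [dotProduct_mulVec, ← mulVec_transpose, hS.eq, dotProduct_comm]

variable {F : Type*} [Field F] {n : ℕ}

section NodeData

variable {κ : Type*} [Fintype κ]

/-- The data stored in node `i` as a linear function of the pair `(S₁, S₂) = (S 0, S 1)`. For
symmetric matrices, `(S₁ + λᵢ S₂) φᵢ` is the transpose of the `i`-th row of `Ψ M`. -/
def nodeData (Φ : Matrix (Fin n) κ F) (lam : Fin n → F) (i : Fin n) :
    (Fin 2 → Matrix κ κ F) →ₗ[F] (κ → F) :=
  (mulVecBilin F F).flip (Φ i) ∘ₗ (LinearMap.proj 0 + lam i • LinearMap.proj 1)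

variable {Φ : Matrix (Fin n) κ F} {lam : Fin n → F} {S : Fin 2 → Matrix κ κ F}

theorem nodeData_apply (i : Fin n) :
    nodeData Φ lam i S = S 0 *ᵥ Φ i + lam i • S 1 *ᵥ Φ i := by
  rw [← smul_mulVec, ← add_mulVec]
  rfl

theorem dotProduct_mulVec_eq_zero_of_nodeData (hS : ∀ s, (S s).IsSymm) {i j : Fin n}
    (hij : lam i ≠ lam j) (hi : nodeData Φ lam i S = 0) (hj : nodeData Φ lam j S = 0)
    (s : Fin 2) : Φ j ⬝ᵥ S s *ᵥ Φ i = 0 := by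
  have hji : Φ j ⬝ᵥ S 0 *ᵥ Φ i + lam i * (Φ j ⬝ᵥ S 1 *ᵥ Φ i) = 0 := by
    rw [← smul_eq_mul, ← dotProduct_smul, ← dotProduct_add, ← nodeData_apply, hi,
      dotProduct_zero]
  have hij' : Φ j ⬝ᵥ S 0 *ᵥ Φ i + lam j * (Φ j ⬝ᵥ S 1 *ᵥ Φ i) = 0 := by
    rw [dotProduct_mulVec_comm_of_isSymm (hS 0), dotProduct_mulVec_comm_of_isSymm (hS 1),
      ← smul_eq_mul, ← dotProduct_smul, ← dotProduct_add, ← nodeData_apply, hj, dotProduct_zero]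
  have hone : Φ j ⬝ᵥ S 1 *ᵥ Φ i = 0 := by
    refine (mul_eq_zero.1 ?_).resolve_left (sub_ne_zero.2 hij)
    linear_combination hji - hij'
  have hzero : Φ j ⬝ᵥ S 0 *ᵥ Φ i = 0 := by
    rwa [hone, mul_zero, add_zero] at hji
  fin_cases s
  exacts [hzero, hone]

theorem eq_zero_of_nodeData_eq_zero {j : ℕ} (hΦ : AnyRowsIndependent j Φ)
    (hκ : Fintype.card κ ≤ j) (hlam : Function.Injective lam) (hS : ∀ s, (S s).IsSymm)
    {K : Finset (Fin n)} (hK : K.card = j + 1) (hdata : ∀ i ∈ K, nodeData Φ lam i S = 0) :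
    S = 0 := by
  have hmulVec : ∀ s, ∀ i ∈ K, S s *ᵥ Φ i = 0 := fun s i hi => by
    have hcard : (K.erase i).card = j := by
      rw [Finset.card_erase_of_mem hi, hK, Nat.add_sub_cancel]
    refine hΦ.eq_zero_of_dotProduct_eq_zero hκ hcard fun i' hi' => ?_
    obtain ⟨hne, hi'⟩ := Finset.mem_erase.1 hi'
    rw [dotProduct_comm]
    exact dotProduct_mulVec_eq_zero_of_nodeData hS (hlam.ne hne.symm) (hdata i hi) (hdata i' hi') s
  obtain ⟨I, hIK, hI⟩ := Finset.exists_subset_card_eq (hK.ge.trans' (Nat.le_succ j))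
  exact funext fun s => hΦ.eq_zero_of_mulVec_eq_zero hκ hI fun i hi => hmulVec s i (hIK hi)

end NodeData

variable {α : ℕ} {Φ : Matrix (Fin n) (Fin α) F} {lam : Fin n → F}

theorem nodeData_dotProduct {S : Fin 2 → Matrix (Fin α) (Fin α) F} (hS : ∀ s, (S s).IsSymm)
    (i f : Fin n) : nodeData Φ lam i S ⬝ᵥ Φ f =
      Sum.elim (S 0 *ᵥ Φ f) (S 1 *ᵥ Φ f) ⬝ᵥ encodingMatrix Φ lam i := by
  rw [encodingMatrix_apply, sumElim_dotProduct_sumElim, nodeData_apply, dotProduct_comm,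
    dotProduct_add, dotProduct_smul, dotProduct_smul, dotProduct_mulVec_comm_of_isSymm (hS 0),
    dotProduct_mulVec_comm_of_isSymm (hS 1), dotProduct_comm (Φ i), dotProduct_comm (Φ i)]

variable {ℓ m : ℕ}

/-- The pair `(S₁, S₂)` as a linear function of the message and the random symbols. -/
def inputMatrices : ((MessageIndex α ℓ m → F) × (RandomIndex α ℓ m → F)) →ₗ[F]
    (Fin 2 → Matrix (Fin α) (Fin α) F) where
  toFun p := symmMatrix p.1 p.2
  map_add' p q := by
    ext s i j
    simp only [symmMatrix, of_apply, Pi.add_apply, Matrix.add_apply, Prod.fst_add, Prod.snd_add]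
    split <;> rfl
  map_smul' a p := by
    ext s i j
    simp only [symmMatrix, of_apply, Pi.smul_apply, Matrix.smul_apply, Prod.smul_fst,
      Prod.smul_snd, RingHom.id_apply]
    split <;> rfl

theorem isSymm_inputMatrices (p : (MessageIndex α ℓ m → F) × (RandomIndex α ℓ m → F))
    (s : Fin 2) : (inputMatrices p s).IsSymm := by
  ext i j
  simp only [inputMatrices, symmMatrix, LinearMap.coe_mk, AddHom.coe_mk, transpose_apply,
    of_apply, Sym2.eq_swap (a := j)]

theorem inputMatrices_injective :
    Function.Injective (inputMatrices : ((MessageIndex α ℓ m → F) × (RandomIndex α ℓ m → F)) →ₗ[F]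
      (Fin 2 → Matrix (Fin α) (Fin α) F)) := by
  rintro ⟨u, r⟩ ⟨u', r'⟩ heq
  have hentry : ∀ s i j, symmMatrix u r s i j = symmMatrix u' r' s i j :=
    fun s i j => congrFun (congrFun (congrFun heq s) i) j
  refine Prod.ext (funext ?_) (funext ?_) <;>
  · rintro ⟨⟨s, z⟩, hz⟩
    induction z using Sym2.ind with | _ i j =>
    simpa only [symmMatrix, of_apply, hz, dite_true, dite_false] using hentry s i j

theorem secureCode_store (u : MessageIndex α ℓ m → F) (r : RandomIndex α ℓ m → F) (i : Fin n) :
    (secureCode Φ lam ℓ m).store u r i = nodeData Φ lam i (inputMatrices (u, r)) := by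
  have hrow : (secureCode Φ lam ℓ m).store u r i =
      encodingMatrix Φ lam i ᵥ* messageMatrix u r := rfl
  have hsymm := isSymm_inputMatrices (u, r)
  rw [hrow, encodingMatrix_apply, messageMatrix, sumElim_vecMul_fromRows, smul_vecMul,
    ← mulVec_transpose, ← mulVec_transpose, nodeData_apply]
  exact congrArg₂ (fun S₁ S₂ => S₁ *ᵥ Φ i + lam i • S₂ *ᵥ Φ i) (hsymm 0).eq (hsymm 1).eq

theorem secureCode_canReconstruct (hΦ : AnyRowsIndependent α Φ)
    (hlam : Function.Injective lam) : (secureCode Φ lam ℓ m).CanReconstruct (α + 1) := by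
  intro K hK u u' r r' heq
  have hzero : inputMatrices ((u, r) - (u', r')) = 0 := by
    refine eq_zero_of_nodeData_eq_zero hΦ (Fintype.card_fin α).le hlam (isSymm_inputMatrices _) hK
      fun i hi => ?_
    rw [map_sub, map_sub, ← secureCode_store, ← secureCode_store, heq i hi, sub_self]
  rw [map_sub, sub_eq_zero] at hzero
  exact Prod.mk.inj (inputMatrices_injective hzero)

theorem secureCode_canRepair (hΨ : AnyRowsIndependent (2 * α) (encodingMatrix Φ lam)) :
    (secureCode Φ lam ℓ m).CanRepair (2 * α) := by
  intro op u u' r r' heq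
  set S := inputMatrices ((u, r) - (u', r')) with hS
  have hnodeData : ∀ i, nodeData Φ lam i S = (secureCode Φ lam ℓ m).store u r i -
      (secureCode Φ lam ℓ m).store u' r' i := fun i => by
    rw [hS, map_sub, map_sub, secureCode_store, secureCode_store]
  have hcard : Fintype.card (Fin α ⊕ Fin α) ≤ 2 * α := by
    rw [Fintype.card_sum, Fintype.card_fin, two_mul]
  have helim : Sum.elim (S 0 *ᵥ Φ op.failed) (S 1 *ᵥ Φ op.failed) = 0 := by
    refine hΨ.eq_zero_of_dotProduct_eq_zero hcard op.card_helpers fun j hj => ?_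
    rw [← nodeData_dotProduct (isSymm_inputMatrices _), hnodeData, sub_dotProduct, sub_eq_zero]
    exact congrFun (heq j hj) 0
  have hS₁ : S 0 *ᵥ Φ op.failed = 0 := congrArg (· ∘ Sum.inl) helim
  have hS₂ : S 1 *ᵥ Φ op.failed = 0 := congrArg (· ∘ Sum.inr) helim
  rw [← sub_eq_zero, ← hnodeData, nodeData_apply, hS₁, hS₂, smul_zero, add_zero]

theorem secureCode_isMSR (h : IsAdmissible Φ lam ℓ m) :
    (secureCode Φ lam ℓ m).IsMSR (α + 1) (2 * α) where
  card_input := by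
    rw [add_comm, card_randomIndex_add_card_messageIndex, mul_comm]
  repair_bandwidth := by
    rw [Nat.add_sub_cancel, mul_one, mul_one, two_mul]
  reconstruct := secureCode_canReconstruct h.phi_rows h.lam_injective
  repair := secureCode_canRepair h.psi_rows

end Code

/-! ### The eavesdropper's view -/

section Observer

open Matrix

variable {n α ℓ m : ℕ}

/-- An eavesdropper that reads exactly `ℓ` nodes and hears everything sent in repairs of exactly
`m` of them. Since `S₂ φ_f`, for a repaired node `f`, is determined by its inner products with the
`φᵢ` of the other stored nodes and with the `φₓ` of `α + 1 - ℓ` further nodes, the repair traffic is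
encoded by these further nodes, the `probes`. -/
structure MaximalObserver (n α ℓ m : ℕ) where
  stored : Finset (Fin n)
  repaired : Finset (Fin n)
  probes : Finset (Fin n)
  card_stored : stored.card = ℓ
  card_repaired : repaired.card = m
  repaired_subset : repaired ⊆ stored
  disjoint_probes : Disjoint stored probes
  add_card_probes : ℓ + probes.card = α + 1

theorem Eavesdropper.exists_maximalObserver {d : ℕ} (E : Eavesdropper n d ℓ m) (hn : α < n)
    (hℓ : ℓ ≤ α) (hm : m ≤ ℓ) :
    ∃ T : MaximalObserver n α ℓ m, E.stored ⊆ T.stored ∧ E.repaired ⊆ T.repaired := by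
  obtain ⟨L, hEL, hL⟩ := Finset.exists_superset_card_eq E.card_stored
    (show ℓ ≤ Fintype.card (Fin n) by rw [Fintype.card_fin]; omega)
  obtain ⟨D, hED, hDL, hD⟩ := Finset.exists_subsuperset_card_eq (E.repaired_subset.trans hEL)
    E.card_repaired (hm.trans hL.ge)
  obtain ⟨X, hXL, hX⟩ := Finset.exists_subset_card_eq (s := Lᶜ) (n := α + 1 - ℓ)
    (by rw [Finset.card_compl, Fintype.card_fin]; omega)
  exact ⟨⟨L, D, X, hL, hD, hDL, (Finset.disjoint_left.2 fun _ hi hiX =>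
    Finset.mem_compl.1 (hXL hiX) hi), by omega⟩, hEL, hED⟩

variable {F : Type*} [Field F]

/-- The observed data as a linear function of `(S₁, S₂)`: the data stored in the `stored` nodes, and
the values `φₓᵀ S₂ φ_f` for the probes `x` and the repaired nodes `f`. Its codomain has dimension
`ℓα + (α + 1 - ℓ)m`, the number of random symbols. -/
def reducedView (Φ : Matrix (Fin n) (Fin α) F) (lam : Fin n → F) (T : MaximalObserver n α ℓ m) :
    (Fin 2 → Matrix (Fin α) (Fin α) F) →ₗ[F]
      (T.stored → Fin α → F) × (T.probes × T.repaired → F) :=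
  (LinearMap.pi fun i : T.stored => nodeData Φ lam i).prod
    (LinearMap.pi fun q : T.probes × T.repaired => dotProductBilin F F (Φ q.1) ∘ₗ
      (mulVecBilin F F).flip (Φ q.2) ∘ₗ LinearMap.proj 1)

variable {Φ : Matrix (Fin n) (Fin α) F} {lam : Fin n → F} {T : MaximalObserver n α ℓ m}
  {S : Fin 2 → Matrix (Fin α) (Fin α) F}

theorem nodeData_eq_zero_of_reducedView (hT : reducedView Φ lam T S = 0) {i : Fin n}
    (hi : i ∈ T.stored) : nodeData Φ lam i S = 0 :=
  congrFun (congrArg Prod.fst hT) ⟨i, hi⟩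

theorem dotProduct_mulVec_eq_zero_of_reducedView (hT : reducedView Φ lam T S = 0) {x f : Fin n}
    (hx : x ∈ T.probes) (hf : f ∈ T.repaired) : Φ x ⬝ᵥ S 1 *ᵥ Φ f = 0 :=
  congrFun (congrArg Prod.snd hT) (⟨x, hx⟩, ⟨f, hf⟩)

theorem mulVec_eq_zero_of_reducedView (hΦ : AnyRowsIndependent α Φ)
    (hlam : Function.Injective lam) (hS : ∀ s, (S s).IsSymm) (hT : reducedView Φ lam T S = 0)
    {f : Fin n} (hf : f ∈ T.repaired) (s : Fin 2) : S s *ᵥ Φ f = 0 := by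
  have hfL := T.repaired_subset hf
  have hcard : (T.stored.erase f ∪ T.probes).card = α := by
    rw [Finset.card_union_of_disjoint (T.disjoint_probes.mono_left (Finset.erase_subset _ _))]
    have := Finset.card_erase_add_one hfL
    have := T.card_stored
    have := T.add_card_probes
    omega
  have hone : S 1 *ᵥ Φ f = 0 := by
    refine hΦ.eq_zero_of_dotProduct_eq_zero (Fintype.card_fin α).le hcard fun j hj => ?_
    rw [dotProduct_comm]
    rcases Finset.mem_union.1 hj with hj | hj
    · obtain ⟨hne, hj⟩ := Finset.mem_erase.1 hj
      exact dotProduct_mulVec_eq_zero_of_nodeData hS (hlam.ne hne.symm)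
        (nodeData_eq_zero_of_reducedView hT hfL) (nodeData_eq_zero_of_reducedView hT hj) 1
    · exact dotProduct_mulVec_eq_zero_of_reducedView hT hj hf
  have hzero : S 0 *ᵥ Φ f = 0 := by
    simpa only [nodeData_apply, hone, smul_zero, add_zero]
      using nodeData_eq_zero_of_reducedView hT hfL
  fin_cases s
  exacts [hzero, hone]

theorem row_eq_zero_of_reducedView (h : IsAdmissible Φ lam ℓ m) (hS : ∀ s, (S s).IsSymm)
    (hmsg : ∀ s c c', (s, s(c, c')) ∉ randomPositions α ℓ m → S s c c' = 0)
    (hT : reducedView Φ lam T S = 0) {c : Fin α} (hmc : m ≤ c.val) (hℓc : ℓ - 1 ≤ c.val) :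
    S 1 c = 0 := by
  refine h.first_m.eq_zero_of_dotProduct_firstColumns T.card_repaired (fun c' hc' => ?_)
    fun f hf => congrFun
      (mulVec_eq_zero_of_reducedView h.phi_rows h.lam_injective hS hT hf 1) c
  refine hmsg 1 c c' (notMem_randomPositions_one.2 ⟨?_, fun hlt => ?_⟩)
  · simp only [Sym2.ball, hmc, hc', and_self]
  · exact (hlt c (Sym2.mem_mk_left c c')).not_ge hℓc

theorem snd_eq_zero_of_reducedView (h : IsAdmissible Φ lam ℓ m) (hm : m ≤ ℓ)
    (hS : ∀ s, (S s).IsSymm)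
    (hmsg : ∀ s c c', (s, s(c, c')) ∉ randomPositions α ℓ m → S s c c' = 0)
    (hT : reducedView Φ lam T S = 0) : S 1 = 0 := by
  rcases hm.eq_or_lt with rfl | hlt
  · refine h.first_m.eq_zero_of_isSymm_of_mulVec_firstColumns T.card_repaired (hS 1) ?_
      fun f hf => mulVec_eq_zero_of_reducedView h.phi_rows h.lam_injective hS hT hf 1
    exact fun c c' hc _ =>
      congrFun (row_eq_zero_of_reducedView h hS hmsg hT hc ((Nat.sub_le _ _).trans hc)) c'
  · have hrow : ∀ c : Fin α, ℓ - 1 ≤ c.val → S 1 c = 0 := fun c hc =>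
      row_eq_zero_of_reducedView h hS hmsg hT ((Nat.le_sub_one_of_lt hlt).trans hc) hc
    have hcard : ∀ i ∈ T.stored, (T.stored.erase i).card = ℓ - 1 := fun i hi => by
      rw [Finset.card_erase_of_mem hi, T.card_stored]
    have hmulVec : ∀ i ∈ T.stored, S 1 *ᵥ Φ i = 0 := fun i hi => by
      refine h.first_ell_sub_one.eq_zero_of_dotProduct_firstColumns (hcard i hi)
        (fun c hc => ?_) fun j hj => ?_
      · rw [mulVec, hrow c hc, zero_dotProduct]
      · obtain ⟨hne, hj⟩ := Finset.mem_erase.1 hj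
        rw [dotProduct_comm]
        exact dotProduct_mulVec_eq_zero_of_nodeData hS (h.lam_injective.ne hne.symm)
          (nodeData_eq_zero_of_reducedView hT hi) (nodeData_eq_zero_of_reducedView hT hj) 1
    obtain ⟨i, hi⟩ := Finset.card_pos.1 (T.card_stored ▸ Nat.zero_lt_of_lt hlt)
    exact h.first_ell_sub_one.eq_zero_of_isSymm_of_mulVec_firstColumns (hcard i hi) (hS 1)
      (fun c c' hc _ => congrFun (hrow c hc) c')
      fun j hj => hmulVec j (Finset.mem_of_mem_erase hj)

theorem eq_zero_of_reducedView_eq_zero (h : IsAdmissible Φ lam ℓ m) (hm : m ≤ ℓ)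
    (hS : ∀ s, (S s).IsSymm)
    (hmsg : ∀ s c c', (s, s(c, c')) ∉ randomPositions α ℓ m → S s c c' = 0)
    (hT : reducedView Φ lam T S = 0) : S = 0 := by
  have hone : S 1 = 0 := snd_eq_zero_of_reducedView h hm hS hmsg hT
  have hzero : S 0 = 0 := by
    refine h.first_ell.eq_zero_of_isSymm_of_mulVec_firstColumns T.card_stored (hS 0) ?_
      fun i hi => ?_
    · exact fun c c' hc hc' => hmsg 0 c c' (notMem_randomPositions_zero.2
        (Sym2.ball.2 ⟨hc, hc'⟩))
    · simpa only [nodeData_apply, hone, zero_mulVec, smul_zero, add_zero]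
        using nodeData_eq_zero_of_reducedView hT hi
  ext1 s
  fin_cases s
  exacts [hzero, hone]

theorem exists_map_prod_eq_zero {V W Z : Type*} [AddCommGroup V] [Module F V] [AddCommGroup W]
    [Module F W] [FiniteDimensional F W] [AddCommGroup Z] [Module F Z] [FiniteDimensional F Z]
    (f : V × W →ₗ[F] Z) (hdim : Module.finrank F W = Module.finrank F Z)
    (hf : ∀ w, f (0, w) = 0 → w = 0) (v : V) : ∃ w, f (v, w) = 0 := by
  have hinj : Function.Injective (f ∘ₗ LinearMap.inr F V W) :=
    (injective_iff_map_eq_zero _).2 hf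
  obtain ⟨w, hw⟩ := (LinearMap.injective_iff_surjective_of_finrank_eq_finrank hdim).1 hinj
    (-f (v, 0))
  refine ⟨w, ?_⟩
  rw [← Prod.fst_add_snd (v, w), map_add]
  exact add_eq_zero_iff_neg_eq.2 hw.symm

theorem exists_reducedView_eq_zero (h : IsAdmissible Φ lam ℓ m) (hℓ : ℓ ≤ α) (hm : m ≤ ℓ)
    (T : MaximalObserver n α ℓ m) (u : MessageIndex α ℓ m → F) :
    ∃ r : RandomIndex α ℓ m → F, reducedView Φ lam T (inputMatrices (u, r)) = 0 := by
  refine exists_map_prod_eq_zero (reducedView Φ lam T ∘ₗ inputMatrices) ?_ (fun r hr => ?_) u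
  · rw [Module.finrank_fintype_fun_eq_card, card_randomIndex hℓ hm, Module.finrank_prod,
      Module.finrank_pi_fintype, Module.finrank_fintype_fun_eq_card]
    simp only [Module.finrank_fintype_fun_eq_card, Fintype.card_fin, Finset.sum_const,
      Finset.card_univ, Fintype.card_prod, Fintype.card_coe, T.card_stored, T.card_repaired,
      smul_eq_mul, ← T.add_card_probes, Nat.add_sub_cancel_left]
  · have hzero : inputMatrices ((0 : MessageIndex α ℓ m → F), r) = 0 :=
      eq_zero_of_reducedView_eq_zero h hm (isSymm_inputMatrices _)
        (fun s c c' hmem => dif_neg hmem) hr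
    exact congrArg Prod.snd (inputMatrices_injective (hzero.trans (map_zero _).symm))

theorem secureCode_view_sub {d : ℕ} (E : Eavesdropper n d ℓ m) (u u' : MessageIndex α ℓ m → F)
    (r r' : RandomIndex α ℓ m → F) : (secureCode Φ lam ℓ m).view E (u - u') (r - r') =
      (secureCode Φ lam ℓ m).view E u r - (secureCode Φ lam ℓ m).view E u' r' := by
  have hstore : ∀ i, (secureCode Φ lam ℓ m).store (u - u') (r - r') i =
      (secureCode Φ lam ℓ m).store u r i - (secureCode Φ lam ℓ m).store u' r' i := fun i => by
    simp only [secureCode_store, ← map_sub, Prod.mk_sub_mk]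
  refine Prod.ext (funext fun i => hstore i) (funext fun t => funext fun j => funext fun _ => ?_)
  exact (congrArg (· ⬝ᵥ Φ (E.op t).failed) (hstore j)).trans (sub_dotProduct _ _ _)

theorem exists_secureCode_view_eq_zero (h : IsAdmissible Φ lam ℓ m) (hn : α < n) (hℓ : ℓ ≤ α)
    (hm : m ≤ ℓ) {d : ℕ} (E : Eavesdropper n d ℓ m) (u : MessageIndex α ℓ m → F) :
    ∃ r, (secureCode Φ lam ℓ m).view E u r = 0 := by
  obtain ⟨T, hstored, hrepaired⟩ := E.exists_maximalObserver hn hℓ hm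
  obtain ⟨r, hr⟩ := exists_reducedView_eq_zero h hℓ hm T u
  refine ⟨r, Prod.ext (funext fun i => ?_) (funext fun t => funext fun j => funext fun _ => ?_)⟩
  · exact (secureCode_store u r i).trans (nodeData_eq_zero_of_reducedView hr (hstored i.2))
  · have hmulVec := mulVec_eq_zero_of_reducedView h.phi_rows h.lam_injective
      (isSymm_inputMatrices _) hr (hrepaired (E.op_failed_mem t))
    change (secureCode Φ lam ℓ m).store u r j ⬝ᵥ Φ (E.op t).failed = 0
    rw [secureCode_store, nodeData_dotProduct (isSymm_inputMatrices _), hmulVec, hmulVec]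
    exact (congrArg (· ⬝ᵥ _) Sum.elim_zero_zero).trans (zero_dotProduct _)

end Observer

/-! ### Security as independence -/

section Probability

section Independence

variable {Ω X Y : Type*} [MeasurableSpace Ω] [MeasurableSpace X] [MeasurableSpace Y]

theorem mutualInformation_eq_zero_iff_indepFun {μ : Measure Ω} [IsFiniteMeasure μ] {f : Ω → X}
    {g : Ω → Y} (hf : AEMeasurable f μ) (hg : AEMeasurable g μ) :
    mutualInformation μ f g = 0 ↔ IndepFun f g μ := by
  rw [mutualInformation, InformationTheory.klDiv_eq_zero_iff,
    indepFun_iff_map_prod_eq_prod_map_map hf hg]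

theorem indepFun_fst_of_map_eq {ν : Measure X} [IsProbabilityMeasure ν] {P : Measure Ω}
    [IsProbabilityMeasure P] {g : X → Ω → Y} (hg : Measurable (Function.uncurry g)) {Q : Measure Y}
    (hQ : ∀ x, P.map (g x) = Q) : IndepFun Prod.fst (Function.uncurry g) (ν.prod P) := by
  have hpres : MeasurePreserving (fun p : X × Ω => (p.1, g p.1 p.2)) (ν.prod P) (ν.prod Q) :=
    (MeasurePreserving.id ν).skew_product hg (Filter.Eventually.of_forall hQ)
  have : IsProbabilityMeasure Q := by
    obtain ⟨x⟩ := nonempty_of_isProbabilityMeasure ν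
    exact hQ x ▸ Measure.isProbabilityMeasure_map hg.of_uncurry_left.aemeasurable
  have hfst : (ν.prod P).map Prod.fst = ν := measurePreserving_fst.map_eq
  have hsnd : (ν.prod P).map (Function.uncurry g) = Q :=
    (measurePreserving_snd.comp hpres).map_eq
  rw [indepFun_iff_map_prod_eq_prod_map_map measurable_fst.aemeasurable hg.aemeasurable, hfst,
    hsnd]
  exact hpres.map_eq

theorem exists_eq_of_indepFun [MeasurableSingletonClass X] [MeasurableSingletonClass Y]
    {μ : Measure Ω} (hμ : ∀ ω, μ {ω} ≠ 0) {f : Ω → X} {g : Ω → Y} (h : IndepFun f g μ)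
    (ω₁ ω₂ : Ω) : ∃ ω, f ω = f ω₁ ∧ g ω = g ω₂ := by
  have hf : μ (f ⁻¹' {f ω₁}) ≠ 0 := fun h0 => hμ ω₁ (measure_mono_null (by simp) h0)
  have hg : μ (g ⁻¹' {g ω₂}) ≠ 0 := fun h0 => hμ ω₂ (measure_mono_null (by simp) h0)
  refine nonempty_of_measure_ne_zero (μ := μ) (s := f ⁻¹' {f ω₁} ∩ g ⁻¹' {g ω₂}) ?_
  rw [h.measure_inter_preimage_eq_mul _ _ (measurableSet_singleton _) (measurableSet_singleton _)]
  exact mul_ne_zero hf hg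

end Independence

section Uniform

variable {Ω : Type*} [Finite Ω] [MeasurableSpace Ω] [MeasurableSingletonClass Ω]

theorem pi_uniformOn_univ (Ω ρ : Type*) [Finite Ω] [MeasurableSpace Ω] [MeasurableSingletonClass Ω]
    [Fintype ρ] : (Measure.pi fun _ : ρ => uniformOn (Set.univ : Set Ω)) =
      uniformOn (Set.univ : Set (ρ → Ω)) := by
  rw [← uniformOn_pi, Set.pi_univ]

theorem uniformOn_univ_map_perm (σ : Equiv.Perm Ω) :
    (uniformOn (Set.univ : Set Ω)).map σ = uniformOn (Set.univ : Set Ω) := by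
  have := Fintype.ofFinite Ω
  ext s hs
  rw [Measure.map_apply (measurable_of_countable _) hs, uniformOn_univ, uniformOn_univ,
    ← σ.image_symm_eq_preimage, Measure.count_injective_image σ.symm.injective]

theorem uniformOn_univ_singleton_ne_zero (ω : Ω) : uniformOn (Set.univ : Set Ω) {ω} ≠ 0 := by
  rw [Ne, uniformOn_eq_zero_iff Set.finite_univ, Set.univ_inter]
  exact Set.singleton_ne_empty ω

end Uniform

variable {A ι ρ : Type*} [Finite A] [Nonempty A] [MeasurableSpace A] [MeasurableSingletonClass A]
  [Finite ι] [Fintype ρ] {n α β d ℓ m : ℕ} {C : StorageCode A ι ρ n α β}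

theorem StorageCode.isSecure_of_perm (u₀ : ι → A)
    (h : ∀ (E : Eavesdropper n d ℓ m) (u : ι → A), ∃ σ : Equiv.Perm (ρ → A),
      ∀ r, C.view E u r = C.view E u₀ (σ r)) : C.IsSecure d ℓ m := by
  intro ν hν E
  have hview : Measurable (Function.uncurry (C.view E)) := measurable_of_countable _
  refine (mutualInformation_eq_zero_iff_indepFun measurable_fst.aemeasurable
    hview.aemeasurable).2 ?_
  rw [pi_uniformOn_univ]
  refine indepFun_fst_of_map_eq hview
    (Q := (uniformOn (Set.univ : Set (ρ → A))).map (C.view E u₀)) fun u => ?_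
  obtain ⟨σ, hσ⟩ := h E u
  rw [show C.view E u = C.view E u₀ ∘ σ from funext hσ,
    ← Measure.map_map (measurable_of_countable _) (measurable_of_countable _),
    uniformOn_univ_map_perm]

theorem StorageCode.IsSecure.exists_view_eq (hC : C.IsSecure d ℓ m) (E : Eavesdropper n d ℓ m)
    (u u' : ι → A) (r' : ρ → A) : ∃ r, C.view E u r = C.view E u' r' := by
  set ν := uniformOn (Set.univ : Set (ι → A))
  have hview : Measurable (Function.uncurry (C.view E)) := measurable_of_countable _
  have hindep := (mutualInformation_eq_zero_iff_indepFun measurable_fst.aemeasurable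
    hview.aemeasurable).1 (hC ν E)
  rw [pi_uniformOn_univ] at hindep
  have hpos : ∀ ω, (ν.prod (uniformOn (Set.univ : Set (ρ → A)))) {ω} ≠ 0 := fun ω => by
    rw [← Set.singleton_prod_singleton, Measure.prod_prod]
    exact mul_ne_zero (uniformOn_univ_singleton_ne_zero _) (uniformOn_univ_singleton_ne_zero _)
  obtain ⟨⟨u, r⟩, rfl, hr⟩ := exists_eq_of_indepFun hpos hindep (u, r') (u', r')
  exact ⟨r, hr⟩

end Probability

theorem secureCode_isSecure {F : Type*} [Field F] [Finite F] [MeasurableSpace F]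
    [MeasurableSingletonClass F] {n α ℓ m d : ℕ} {Φ : Matrix (Fin n) (Fin α) F} {lam : Fin n → F}
    (h : IsAdmissible Φ lam ℓ m) (hn : α < n) (hℓ : ℓ ≤ α) (hm : m ≤ ℓ) :
    (secureCode Φ lam ℓ m).IsSecure d ℓ m := by
  refine StorageCode.isSecure_of_perm 0 fun E u => ?_
  obtain ⟨r₀, hr₀⟩ := exists_secureCode_view_eq_zero h hn hℓ hm E u
  refine ⟨Equiv.subRight r₀, fun r => ?_⟩
  rw [Equiv.subRight_apply, ← sub_self u, secureCode_view_sub, hr₀, sub_zero]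

/-! ### The upper bound on the number of message symbols -/

section Bound

variable {A ι ρ : Type*} {n α β k d ℓ m : ℕ} {C : StorageCode A ι ρ n α β}

theorem input_eq_of_repair (hrec : C.CanReconstruct k) (hrep : C.CanRepair d) (op : RepairOp n d)
    {G : Finset (Fin n)} (hG : G ⊆ op.helpers) (hGk : G.card + 1 = k) {u u' : ι → A}
    {r r' : ρ → A} (hstore : ∀ i ∈ G, C.store u r i = C.store u' r' i)
    (hsend : ∀ i ∈ op.helpers \ G, C.send op.failed op.helpers i (C.store u r i) =
      C.send op.failed op.helpers i (C.store u' r' i)) : u = u' ∧ r = r' := by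
  have hfailed : C.store u r op.failed = C.store u' r' op.failed := by
    refine hrep op u u' r r' fun i hi => ?_
    by_cases hiG : i ∈ G
    · rw [hstore i hiG]
    · exact hsend i (Finset.mem_sdiff.2 ⟨hi, hiG⟩)
  refine hrec (insert op.failed G) ?_ u u' r r' (Finset.forall_mem_insert _ _ _ |>.2
    ⟨hfailed, hstore⟩)
  rw [Finset.card_insert_of_notMem fun hmem => op.failed_notMem (hG hmem), hGk]

theorem RepairOp.exists_failed_eq_subset_helpers {f : Fin n} {G : Finset (Fin n)} (hf : f ∉ G)
    (hG : G.card ≤ d) (hdn : d < n) : ∃ op : RepairOp n d, op.failed = f ∧ G ⊆ op.helpers := by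
  have hcard : d ≤ (Finset.univ.erase f).card := by
    rw [Finset.card_erase_of_mem (Finset.mem_univ f), Finset.card_fin]
    omega
  obtain ⟨H, hGH, hHf, hH⟩ :=
    Finset.exists_subsuperset_card_eq (fun i hi => by simpa using ne_of_mem_of_not_mem hi hf)
      hG hcard
  exact ⟨⟨f, H, hH, fun hmem => Finset.notMem_erase f _ (hHf hmem)⟩, rfl, hGH⟩

/-- The possible contents of node `i`, given that the eavesdropper sees `v`. -/
def compatibleContents (C : StorageCode A ι ρ n α β) (E : Eavesdropper n d ℓ m)
    (v : (E.stored → Fin α → A) × ((t : Fin E.numOps) → (E.op t).helpers → Fin β → A))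
    (i : Fin n) : Set (Fin α → A) :=
  {x | ∃ u r, C.view E u r = v ∧ C.store u r i = x}

namespace Eavesdropper

variable {L : Finset (Fin n)}

/-- The eavesdropper that reads the nodes of `L` and listens to no repair. -/
def ofStored (d m : ℕ) (hL : L.card ≤ ℓ) : Eavesdropper n d ℓ m where
  stored := L
  card_stored := hL
  repaired := ∅
  repaired_subset := Finset.empty_subset L
  card_repaired := m.zero_le
  numOps := 0
  op := Fin.elim0
  op_failed_mem t := t.elim0

/-- The eavesdropper that reads the nodes of `L` and listens to a single repair. -/
def ofRepairOp (hL : L.card ≤ ℓ) (hm : 1 ≤ m) {op : RepairOp n d} (hop : op.failed ∈ L) :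
    Eavesdropper n d ℓ m where
  stored := L
  card_stored := hL
  repaired := {op.failed}
  repaired_subset := Finset.singleton_subset_iff.2 hop
  card_repaired := hm
  numOps := 1
  op _ := op
  op_failed_mem _ := Finset.mem_singleton_self _

end Eavesdropper

variable [Fintype ι] [Fintype ρ]

theorem StorageCode.IsMSR.sub_bandwidth_eq (hC : C.IsMSR k d) (hk : 1 ≤ k) (hkd : k ≤ d) :
    α - β = (d - k) * β := by
  obtain ⟨e, rfl⟩ := Nat.exists_eq_add_of_le hkd
  obtain ⟨k, rfl⟩ := Nat.exists_eq_add_of_le' hk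
  have hbandwidth := hC.repair_bandwidth
  rw [Nat.add_sub_cancel] at hbandwidth
  have hα : α = e * β + β := by linarith
  rw [hα, Nat.add_sub_cancel, Nat.add_sub_cancel_left]

variable [Finite A]

theorem StorageCode.IsMSR.exists_store_eq (hC : C.IsMSR k d) {K : Finset (Fin n)}
    (hK : K.card = k) (x : Fin n → Fin α → A) : ∃ u r, ∀ i ∈ K, C.store u r i = x i := by
  classical
  have := Fintype.ofFinite A
  let stores : (ι → A) × (ρ → A) → K → Fin α → A := fun p i => C.store p.1 p.2 i
  have hinj : Function.Injective stores := fun p q h =>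
    Prod.ext_iff.2 (hC.reconstruct K hK _ _ _ _ fun i hi => congrFun h ⟨i, hi⟩)
  have hcard : Fintype.card ((ι → A) × (ρ → A)) = Fintype.card (K → Fin α → A) := by
    simp only [Fintype.card_prod, Fintype.card_fun, Fintype.card_coe, Fintype.card_fin, hK]
    rw [← pow_add, hC.card_input, ← pow_mul, mul_comm]
  obtain ⟨p, hp⟩ := ((Fintype.bijective_iff_injective_and_card stores).2 ⟨hinj, hcard⟩).2
    fun i => x i
  exact ⟨p.1, p.2, fun i hi => congrFun hp ⟨i, hi⟩⟩

/-- Fix the contents of `k - 1` of the other helpers: then the content of helper `j` is determined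
by the symbols that it and the remaining `d - k` helpers pass. -/
theorem StorageCode.IsMSR.ncard_send_fiber_le [Nonempty A] (hC : C.IsMSR k d) (hk : 1 ≤ k)
    (hkd : k ≤ d) (op : RepairOp n d) {j : Fin n} (hj : j ∈ op.helpers) (s : Fin β → A) :
    {x | C.send op.failed op.helpers j x = s}.ncard ≤ Nat.card A ^ ((d - k) * β) := by
  obtain ⟨G, hG, hGk⟩ := Finset.exists_subset_card_eq (s := op.helpers.erase j) (n := k - 1)
    (by rw [Finset.card_erase_of_mem hj, op.card_helpers]; omega)
  have hjG : j ∉ G := fun hmem => Finset.notMem_erase j _ (hG hmem)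
  have hGop : G ⊆ op.helpers := hG.trans (Finset.erase_subset _ _)
  obtain ⟨x₀⟩ : Nonempty (Fin α → A) := inferInstance
  have hinput : ∀ x, ∃ u r, C.store u r j = x ∧ ∀ i ∈ G, C.store u r i = x₀ := fun x => by
    obtain ⟨u, r, hur⟩ := hC.exists_store_eq (K := insert j G)
      (by rw [Finset.card_insert_of_notMem hjG]; omega) (Function.update (fun _ => x₀) j x)
    obtain ⟨huj, huG⟩ := (Finset.forall_mem_insert _ _ _).1 hur
    refine ⟨u, r, huj.trans (Function.update_self ..), fun i hi => (huG i hi).trans ?_⟩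
    rw [Function.update_of_ne (ne_of_mem_of_not_mem hi hjG)]
  choose u r huj huG using hinput
  let sent : {x | C.send op.failed op.helpers j x = s} →
      (op.helpers \ insert j G : Finset (Fin n)) → Fin β → A :=
    fun x i => C.send op.failed op.helpers i (C.store (u x) (r x) i)
  have hsent : Function.Injective sent := fun x y hxy => by
    have hinput := input_eq_of_repair (u := u x) (u' := u y) (r := r x) (r' := r y)
      hC.reconstruct hC.repair op hGop (by omega) (fun i hi => (huG x i hi).trans (huG y i hi).symm)
      fun i hi => ?_
    · rw [Subtype.ext_iff, ← huj x, ← huj y, hinput.1, hinput.2]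
    · obtain ⟨hiop, hiG⟩ := Finset.mem_sdiff.1 hi
      obtain rfl | hij := eq_or_ne i j
      · rw [huj, huj, x.2, y.2]
      · exact congrFun hxy ⟨i, Finset.mem_sdiff.2 ⟨hiop, by simp [hij, hiG]⟩⟩
  have hcard : (op.helpers \ insert j G).card = d - k := by
    rw [Finset.card_sdiff_of_subset (Finset.insert_subset hj hGop), op.card_helpers,
      Finset.card_insert_of_notMem hjG]
    omega
  refine (Nat.card_le_card_of_injective sent hsent).trans_eq ?_
  simp only [Nat.card_fun, Nat.card_eq_fintype_card, Fintype.card_coe, Fintype.card_fin, hcard]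
  rw [← pow_mul, mul_comm]

variable [MeasurableSpace A] [MeasurableSingletonClass A] [Nontrivial A]

/-- As every message is compatible with the view, it is determined by compatible contents of the
nodes that are not read. -/
theorem card_message_le_of_ncard_compatibleContents_le (hrec : C.CanReconstruct k)
    (hsec : C.IsSecure d ℓ m) (E : Eavesdropper n d ℓ m) {K : Finset (Fin n)} (hK : K.card = k)
    (hEK : E.stored ⊆ K) (u₀ : ι → A) (r₀ : ρ → A) {t : ℕ}
    (ht : ∀ i ∈ K \ E.stored,
      (compatibleContents C E (C.view E u₀ r₀) i).ncard ≤ Nat.card A ^ t) :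
    Fintype.card ι ≤ (k - E.stored.card) * t := by
  choose r hr using fun u => hsec.exists_view_eq E u u₀ r₀
  let contents : (ι → A) → (i : (K \ E.stored : Finset (Fin n))) →
      compatibleContents C E (C.view E u₀ r₀) i := fun u i => ⟨C.store u (r u) i, u, r u, hr u, rfl⟩
  have hinj : Function.Injective contents := fun u u' h => by
    refine (hrec K hK u u' (r u) (r u') fun i hi => ?_).1
    by_cases hiE : i ∈ E.stored
    · exact congrFun (congrArg Prod.fst ((hr u).trans (hr u').symm)) ⟨i, hiE⟩
    · exact congrArg Subtype.val (congrFun h ⟨i, Finset.mem_sdiff.2 ⟨hi, hiE⟩⟩)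
  refine (Nat.pow_le_pow_iff_right (Finite.one_lt_card (α := A))).1 ?_
  calc Nat.card A ^ Fintype.card ι = Nat.card (ι → A) := by
        rw [Nat.card_fun, Nat.card_eq_fintype_card (α := ι)]
    _ ≤ ∏ i : (K \ E.stored : Finset (Fin n)),
          (compatibleContents C E (C.view E u₀ r₀) i).ncard :=
        (Nat.card_le_card_of_injective contents hinj).trans_eq Nat.card_pi
    _ ≤ (Nat.card A ^ t) ^ (K \ E.stored).card := by
        rw [← Fintype.card_coe]
        exact Finset.prod_le_pow_card _ _ _ fun i _ => ht i i.2
    _ = Nat.card A ^ ((k - E.stored.card) * t) := by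
        rw [Finset.card_sdiff_of_subset hEK, hK, ← pow_mul, mul_comm]

theorem card_message_le_mul (hrec : C.CanReconstruct k) (hsec : C.IsSecure d ℓ m) (hkn : k ≤ n)
    (hℓ : ℓ ≤ k) : Fintype.card ι ≤ (k - ℓ) * α := by
  obtain ⟨K, -, hK⟩ := Finset.exists_subset_card_eq (s := (Finset.univ : Finset (Fin n))) (n := k)
    (hkn.trans_eq (Finset.card_fin n).symm)
  obtain ⟨L, hLK, hL⟩ := Finset.exists_subset_card_eq (hK ▸ hℓ)
  obtain ⟨a⟩ : Nonempty A := inferInstance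
  have hbound := card_message_le_of_ncard_compatibleContents_le hrec hsec
    (Eavesdropper.ofStored d m hL.le) hK hLK (fun _ => a) (fun _ => a) (t := α) fun i _ => by
      refine (Set.ncard_le_card _).trans_eq ?_
      rw [Nat.card_fun, Nat.card_eq_fintype_card (α := Fin α), Fintype.card_fin]
  exact hL ▸ hbound

theorem card_message_le_mul_sub (hC : C.IsMSR k d) (hsec : C.IsSecure d ℓ m) (hkd : k ≤ d)
    (hdn : d < n) (hℓ : ℓ ≤ k) (hm : m ≤ ℓ) (hm1 : 1 ≤ m) :
    Fintype.card ι ≤ (k - ℓ) * (α - β) := by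
  obtain ⟨K, -, hK⟩ := Finset.exists_subset_card_eq (s := (Finset.univ : Finset (Fin n))) (n := k)
    (hkd.trans (hdn.le.trans_eq (Finset.card_fin n).symm))
  obtain ⟨L, hLK, hL⟩ := Finset.exists_subset_card_eq (hK ▸ hℓ)
  obtain ⟨f, hf⟩ : L.Nonempty := Finset.card_pos.1 (by omega)
  obtain ⟨op, rfl, hop⟩ := RepairOp.exists_failed_eq_subset_helpers (G := K \ L)
    (fun hmem => (Finset.mem_sdiff.1 hmem).2 hf)
    (((Finset.card_le_card Finset.sdiff_subset).trans_eq hK).trans hkd) hdn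
  obtain ⟨a⟩ : Nonempty A := inferInstance
  rw [hC.sub_bandwidth_eq (by omega) hkd, ← hL]
  refine card_message_le_of_ncard_compatibleContents_le hC.reconstruct hsec
    (Eavesdropper.ofRepairOp hL.le hm1 hf) hK hLK (fun _ => a) (fun _ => a) fun i hi => ?_
  let s := C.send op.failed op.helpers i (C.store (fun _ => a) (fun _ => a) i)
  have hsub : compatibleContents C (Eavesdropper.ofRepairOp hL.le hm1 hf)
      (C.view (Eavesdropper.ofRepairOp hL.le hm1 hf) (fun _ => a) (fun _ => a)) i ⊆
        {x | C.send op.failed op.helpers i x = s} := by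
    rintro _ ⟨u, r, hview, rfl⟩
    exact congrFun (congrFun (congrArg Prod.snd hview) (0 : Fin 1)) ⟨i, hop hi⟩
  exact (Set.ncard_le_ncard hsub).trans (hC.ncard_send_fiber_le (by omega) hkd op (hop hi) s)

theorem card_message_le (hC : C.IsMSR k d) (hsec : C.IsSecure d ℓ m) (hkd : k ≤ d)
    (hdn : d < n) (hℓ : ℓ ≤ k) (hm : m ≤ ℓ) (hm1 : m ≤ 1) :
    Fintype.card ι ≤ (k - ℓ) * (α - m * β) := by
  obtain rfl | rfl := Nat.le_one_iff_eq_zero_or_eq_one.1 hm1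
  · rw [zero_mul, Nat.sub_zero]
    exact card_message_le_mul hC.reconstruct hsec (hkd.trans hdn.le) hℓ
  · rw [one_mul]
    exact card_message_le_mul_sub hC hsec hkd hdn hℓ hm le_rfl

end Bound

end SecureMSR

theorem mainTheorem7 {F : Type*} [Field F] [Fintype F]
    [MeasurableSpace F] [DiscreteMeasurableSpace F]
    (n k ℓ m : ℕ) (hk : 2 ≤ k) (hn : 2 * k - 2 < n) (hℓ : ℓ < k) (hm : m ≤ ℓ) :
    -- the numbers of random symbols and of message symbols
    Fintype.card (SecureMSR.RandomIndex (k - 1) ℓ m) = ℓ * (k - 1) + (k - ℓ) * m ∧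
    Fintype.card (SecureMSR.MessageIndex (k - 1) ℓ m) = (k - ℓ) * (k - 1 - m) ∧
    -- every admissible choice of the encoding matrix gives a secure MSR code
    (∀ (Φ : Matrix (Fin n) (Fin (k - 1)) F) (lam : Fin n → F),
      SecureMSR.IsAdmissible Φ lam ℓ m →
        (SecureMSR.secureCode Φ lam ℓ m).IsMSR k (2 * k - 2) ∧
        (SecureMSR.secureCode Φ lam ℓ m).IsSecure (2 * k - 2) ℓ m) ∧
    -- Vandermonde matrices are admissible
    (∀ x : Fin n → F, (∀ i j, i ≠ j → x i ^ (k - 1) ≠ x j ^ (k - 1)) →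
      SecureMSR.IsAdmissible (Matrix.of fun i (c : Fin (k - 1)) => x i ^ (c : ℕ))
        (fun i => x i ^ (k - 1)) ℓ m) ∧
    -- for `m ≤ 1`, no secure MSR code stores more message symbols
    (m ≤ 1 → ∀ (α β B R : ℕ) (C : SecureMSR.StorageCode F (Fin B) (Fin R) n α β),
      C.IsMSR k (2 * k - 2) → C.IsSecure (2 * k - 2) ℓ m → B ≤ (k - ℓ) * (α - m * β)) := by
  obtain ⟨α, rfl⟩ : ∃ α, k = α + 1 := ⟨k - 1, by omega⟩
  have hd : 2 * (α + 1) - 2 = 2 * α := by omega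
  have hℓα : ℓ ≤ α := Nat.lt_succ_iff.1 hℓ
  refine ⟨SecureMSR.card_randomIndex hℓα hm, SecureMSR.card_messageIndex hℓα hm,
    fun Φ lam h => ?_, fun x hx => ?_, fun hm1 a b B R C hC hS => ?_⟩
  · rw [hd]
    exact ⟨SecureMSR.secureCode_isMSR h, SecureMSR.secureCode_isSecure h (by omega) hℓα hm⟩
  · exact SecureMSR.isAdmissible_vandermonde hℓα (hm.trans hℓα)
      fun i j hij => by_contra fun hne => hx i j hne hij
  · rw [← Fintype.card_fin B]
    exact SecureMSR.card_message_le hC hS (by omega) hn hℓ.le hm hm1
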